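/- Let $(T,\mu,\eta)$ be a monad and $F$ an endofunctor on a category $\mathcal C$, and let $\alpha$ be an ordinal. Regard $\{\beta\mid\beta\le\alpha\}$ (the frame of down-sets of $\alpha$) as a site in which a sieve covers $\beta$ iff the least upper bound of its members is $\beta$, and let $\mathrm{Sh}_{\mathcal C}(\alpha)$ be the category of $\mathcal C$-valued sheaves on it, with inclusion $i$ into presheaves. Assume that $i$ has a left adjoint $a$ and that the constant sheaf functor $\Delta=a\circ\mathrm{const}\colon\mathcal C\to\mathrm{Sh}_{\mathcal C}(\alpha)$ has a right adjoint $\Gamma$ (so that $\Delta\dashv\Gamma$ is defined). For $E\colon\mathcal C\to\mathcal C$ let $\underline{E}$ be the pointwise extension $X\mapsto a(E\circ iX)$; then canonically $\underline{E'}\,\underline{E}\cong\underline{E'E}$ and $\mathrm{Id}\cong\underline{\mathrm{Id}}$, and $\underline{T}$ is a monad on $\mathrm{Sh}_{\mathcal C}(\alpha)$. Let $p(\beta)=\bigvee\{\gamma+1\mid\gamma+1<\beta\}$, let $\blacktriangleright X=a(iX\circ p)$, let $\mathrm{next}\colon\mathrm{Id}\Rightarrow\blacktriangleright$ be given by restriction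 along $p(\beta)\le\beta$ followed by the unit of $a\dashv i$, and let $G=\underline{F}\circ\blacktriangleright$ be the guarded pointwise extension of $F$. A final sequence of $F$ is a limit-preserving functor $f\colon\mathrm{Ord}^{\mathrm{op}}\to\mathcal C$ (so $f(0)$ is terminal and $f(\lambda)=\lim_{\beta<\lambda}f(\beta)$ for limit $\lambda$) with $f(\beta+1)\cong F f(\beta)$ naturally in $\beta$; it is stable at $\alpha$ if $f(\alpha+1)\to f(\alpha)$ is an isomorphism. Suppose that $F$ has a final sequence $f$ that is stable at $\alpha$, and let $\mathrm{fseq}(F)\in\mathrm{Sh}_{\mathcal C}(\alpha)$ be its restriction to $\{\beta\le\alpha\}$. Let $K\colon\mathrm{Sh}_{\mathcal C}(\alpha)\to\mathrm{Kl}(\underline{T})$ be the canonical functor and let $\overline{G}$ be a Kleisli lifting of $G$, i.e. an endofunctor of $\mathrm{Kl}(\underline{T})$ with $\overline{G}K\cong KG$. Then there is an isomorphism $c\colon\mathrm{fseq}(F)\cong G(\mathrm{fseq}(F))$ which at each stage $\beta+1\le\alpha$ is the canonical identification $f(\beta+1)\cong F f(\beta)=F f(p(\beta+1))$ followed by the canonical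 map $F f(p(\beta+1))\to G(\mathrm{fseq}(F))(\beta+1)$ (units of $a\dashv i$), such that: 1. $(\mathrm{fseq}(F),c)$ is a final $G$-coalgebra; 2. its image under $K$, namely $K\,\mathrm{fseq}(F)$ with structure $K\,\mathrm{fseq}(F)\xrightarrow{Kc}KG\,\mathrm{fseq}(F)\cong\overline{G}K\,\mathrm{fseq}(F)$, is a final $\overline{G}$-coalgebra; hence the final $\overline{G}$-coalgebra captures (possibly) infinite trace semantics, meaning that final coalgebras $\nu G$ and $\nu\overline{G}$ exist and $\nu\overline{G}\cong K(\nu G)$; 3. $f(\alpha)$, with the structure $f(\alpha)\cong f(\alpha+1)\cong F f(\alpha)$, is a final $F$-coalgebra, and $\Gamma(\mathrm{fseq}(F))\cong f(\alpha)$; 4. every $TF$-coalgebra $h\colon X\to TFX$ has an infinite trace semantics: there is exactly one $\overline{G}$-coalgebra homomorphism from the $\overline{G}$-coalgebra on $\Delta X$ induced by $\Delta X\xrightarrow{\Delta h}\Delta TFX\to\underline{TF}\,\Delta X\xrightarrow{\underline{TF}(\mathrm{next}_{\Delta X})}\underline{TF}\,{\blacktriangleright}\Delta X\cong\underline{T}\,G\,\Delta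 X$ to the final $\overline{G}$-coalgebra of (2). -/

import Mathlib

open CategoryTheory Opposite

universe w v u

namespace GuardedTrace

/-- The sup topology on a linear order: a sieve covers a stage `a` when `a` is the least upper bound
of the stages that it contains. For the frame of opens of an ordinal this is the canonical
topology. -/
def supTopology (P : Type u) [LinearOrder P] : GrothendieckTopology P where
  sieves a := {S | IsLUB {b | ∃ f : b ⟶ a, S f} a}
  top_mem' a := ⟨fun _ ⟨f, _⟩ => leOfHom f, fun _ h => h ⟨𝟙 a, trivial⟩⟩
  pullback_stable' a c S f hS := by
    refine ⟨fun _ ⟨g, _⟩ => leOfHom g, fun x hx => ?_⟩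
    rcases (leOfHom f).eq_or_lt with rfl | hlt
    · exact hS.2 fun b ⟨g, hg⟩ => hx ⟨g, by
        change S (g ≫ f)
        rwa [Subsingleton.elim (g ≫ f) g]⟩
    · obtain ⟨b, ⟨g, hg⟩, hb⟩ := (lt_isLUB_iff hS).1 hlt
      refine hx ⟨𝟙 c, ?_⟩
      change S (𝟙 c ≫ f)
      rw [Subsingleton.elim (𝟙 c ≫ f) (homOfLE hb.le ≫ g)]
      exact S.downward_closed hg _
  transitive' a S hS R hR := by
    refine ⟨fun _ ⟨g, _⟩ => leOfHom g, fun x hx => hS.2 fun b ⟨g, hg⟩ => ?_⟩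
    exact (hR hg).2 fun c ⟨k, hk⟩ => hx ⟨k ≫ g, hk⟩

/-- The opens of an ordinal `α` with its Alexandrov topology are its down-sets, that is, the ordinals
`β ≤ α`. -/
abbrev Stage (α : Ordinal.{w}) : Type (w + 1) := Set.Iic α

/-- The site of opens of `α`. -/
noncomputable abbrev alexandrov (α : Ordinal.{w}) : GrothendieckTopology (Stage α) :=
  supTopology (Stage α)

/-- The members of the base of successor ordinals strictly below `a`. -/
def succsBelow (a : Ordinal.{w}) : Set Ordinal.{w} := {b | b < a ∧ ∃ β : Ordinal.{w}, b = β + 1}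

theorem mem_upperBounds_succsBelow (a : Ordinal.{w}) : a ∈ upperBounds (succsBelow a) :=
  fun _ h => le_of_lt h.1

/-- The predecessor of a stage: the join of the base opens (successor ordinals) strictly below it. -/
noncomputable def predecessor (α : Ordinal.{w}) : Stage α →o Stage α where
  toFun a := ⟨sSup (succsBelow a.1),
    (csSup_le' (mem_upperBounds_succsBelow a.1)).trans a.2⟩
  monotone' _ b h := csSup_le_csSup' ⟨b.1, mem_upperBounds_succsBelow b.1⟩
    fun _ hc => ⟨lt_of_lt_of_le hc.1 h, hc.2⟩

theorem predecessor_le {α : Ordinal.{w}} (a : Stage α) : predecessor α a ≤ a :=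
  csSup_le' (mem_upperBounds_succsBelow a.1)

theorem predecessor_succ {α β : Ordinal.{w}} (h : β + 1 ≤ α) :
    (predecessor α ⟨β + 1, h⟩).1 = β := by
  apply le_antisymm
  · refine csSup_le' fun b hb => ?_
    exact Order.lt_add_one_iff.1 hb.1
  · refine le_of_forall_lt fun c hc => ?_
    refine lt_of_lt_of_le (Order.lt_add_one_iff.2 le_rfl : c < c + 1)
      (le_csSup ⟨β + 1, mem_upperBounds_succsBelow _⟩ ⟨?_, c, rfl⟩)
    exact lt_of_le_of_lt (Order.add_one_le_of_lt hc) (Order.lt_add_one_iff.2 le_rfl)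

variable {C : Type u} [Category.{v} C]

/-- `C`-valued sheaves on the ordinal `α`. -/
abbrev Sh (C : Type u) [Category.{v} C] (α : Ordinal.{w}) := Sheaf (alexandrov α) C

/-- The stages that are successor ordinals. -/
def IsSuccStage (α : Ordinal.{w}) : ObjectProperty (Stage α) := fun s => ∃ β, s.1 = β + 1

theorem mem_of_cover {α : Ordinal.{w}} {s t : Stage α} (hs : IsSuccStage α s) (h : s ⟶ t)
    {S : Sieve t} (hS : S ∈ alexandrov α t) : S h := by
  obtain ⟨β, hβ⟩ := hs
  have hlt : β < t.1 := lt_of_lt_of_le (by simp [hβ]) (leOfHom h)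
  let b : Stage α := ⟨β, hlt.le.trans t.2⟩
  obtain ⟨c, ⟨g, hg⟩, hc⟩ := (lt_isLUB_iff (b := b) hS).1 hlt
  have hsc : s ≤ c := by
    change s.1 ≤ c.1
    rw [hβ]
    exact Order.add_one_le_of_lt hc
  rw [Subsingleton.elim h (homOfLE hsc ≫ g)]
  exact S.downward_closed hg _

instance (α : Ordinal.{w}) : (IsSuccStage α).ι.IsCoverDense (alexandrov α) where
  is_cover t := by
    refine ⟨fun _ ⟨g, _⟩ => leOfHom g, fun x hx => ?_⟩
    by_contra hlt
    rw [not_le] at hlt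
    let s : (IsSuccStage α).FullSubcategory :=
      ⟨⟨x.1 + 1, (Order.add_one_le_of_lt (show x.1 < t.1 from hlt)).trans t.2⟩, x.1, rfl⟩
    have hlt' : x.1 < t.1 := hlt
    have hst : s.obj ≤ t := show x.1 + 1 ≤ t.1 from Order.add_one_le_of_lt hlt'
    have := hx ⟨homOfLE hst, Presieve.in_coverByImage (IsSuccStage α).ι (Y := s) (homOfLE hst)⟩
    exact absurd this (not_le.2 (Order.lt_add_one_iff.2 le_rfl : x.1 < x.1 + 1))

theorem isIso_map_of_succ {α : Ordinal.{w}} [HasWeakSheafify (alexandrov α) C]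
    {P Q : (Stage α)ᵒᵖ ⥤ C} (f : P ⟶ Q) (hf : ∀ s, IsSuccStage α s → IsIso (f.app (op s))) :
    IsIso ((presheafToSheaf (alexandrov α) C).map f) := by
  rw [← GrothendieckTopology.W_iff]
  intro X hX
  have : IsIso (Functor.whiskerLeft (IsSuccStage α).ι.op f) := by
    have : ∀ s, IsIso ((Functor.whiskerLeft (IsSuccStage α).ι.op f).app s) :=
      fun s => hf _ s.unop.property
    exact NatIso.isIso_of_isIso_app _
  have key : ∀ (R : (Stage α)ᵒᵖ ⥤ C), Function.Bijective
      (fun g : R ⟶ X => Functor.whiskerLeft (IsSuccStage α).ι.op g) := fun R =>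
    (Functor.IsCoverDense.restrictHomEquivHom (G := (IsSuccStage α).ι) (ℱ := R)
      (ℱ' := (⟨X, hX⟩ : Sh C α))).symm.bijective
  rw [← Function.Bijective.of_comp_iff' (key P)]
  have h2 : Function.Bijective (fun g : (IsSuccStage α).ι.op ⋙ Q ⟶ (IsSuccStage α).ι.op ⋙ X =>
      Functor.whiskerLeft (IsSuccStage α).ι.op f ≫ g) :=
    ⟨fun g h e => (cancel_epi _).1 e, fun g => ⟨inv (Functor.whiskerLeft _ f) ≫ g, by simp⟩⟩
  exact h2.comp (key Q)

theorem hasTerminal_of_sheaf {α : Ordinal.{w}} (X : Sh C α) : Limits.HasTerminal C := by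
  let z : Stage α := ⟨0, Set.mem_Iic.2 zero_le⟩
  have hz : (⊥ : Sieve z) ∈ alexandrov α z := by
    refine ⟨fun _ ⟨g, hg⟩ => hg.elim, fun x _ => ?_⟩
    exact (zero_le : (0 : Ordinal.{w}) ≤ x.1)
  exact (X.isTerminalOfBotCover z hz).hasTerminal

section
variable {P : Type*} [Category P] [∀ a b : Pᵒᵖ, Limits.HasProductsOfShape (a ⟶ b) C]

/-- The projections of the right adjoint to evaluation at `s`. -/
noncomputable def skyProj (s : P) (c : C) {t : P} (g : s ⟶ t) :
    ((evaluationRightAdjoint C (op s)).obj c).obj (op t) ⟶ c :=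
  Limits.Pi.π (fun _ : op t ⟶ op s => c) g.op

/-- The tupling for the right adjoint to evaluation at `s`. -/
noncomputable def skyLift (s : P) (c : C) {t : P} {X : C} (q : (s ⟶ t) → (X ⟶ c)) :
    X ⟶ ((evaluationRightAdjoint C (op s)).obj c).obj (op t) :=
  Limits.Pi.lift (fun g : op t ⟶ op s => q g.unop)

theorem skyLift_proj (s : P) (c : C) {t : P} {X : C} (q : (s ⟶ t) → (X ⟶ c)) (g : s ⟶ t) :
    skyLift s c q ≫ skyProj s c g = q g :=
  Limits.Pi.lift_π (fun g : op t ⟶ op s => q g.unop) g.op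

theorem sky_ext {s : P} {c : C} {t : P} {X : C}
    {k l : X ⟶ ((evaluationRightAdjoint C (op s)).obj c).obj (op t)}
    (h : ∀ g : s ⟶ t, k ≫ skyProj s c g = l ≫ skyProj s c g) : k = l :=
  Limits.Pi.hom_ext (f := fun _ : op t ⟶ op s => c) k l fun g => h g.unop

theorem sky_map (s : P) (c : C) {t t' : P} (f : t ⟶ t') (g : s ⟶ t) :
    ((evaluationRightAdjoint C (op s)).obj c).map f.op ≫ skyProj s c g = skyProj s c (g ≫ f) :=
  Limits.Pi.lift_π (fun g : op t ⟶ op s =>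
    Limits.Pi.π (fun _ : op t' ⟶ op s => c) (f.op ≫ g)) g.op

end

theorem isIso_toSheafify_app {α : Ordinal.{w}} [HasWeakSheafify (alexandrov α) C]
    (P : (Stage α)ᵒᵖ ⥤ C) {s : Stage α} (hs : IsSuccStage α s) :
    IsIso ((toSheafify (alexandrov α) P).app (op s)) := by
  have := hasTerminal_of_sheaf ((presheafToSheaf (alexandrov α) C).obj P)
  have (a b : (Stage α)ᵒᵖ) : Limits.HasProductsOfShape (a ⟶ b) C := by
    rcases isEmpty_or_nonempty (a ⟶ b) with h | h
    · exact Limits.hasLimitsOfShape_of_equivalence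
        (Discrete.equivalence (Equiv.equivPEmpty (a ⟶ b))).symm
    · obtain ⟨f⟩ := h
      have : Unique (a ⟶ b) := ⟨⟨f⟩, fun _ => Subsingleton.elim _ _⟩
      exact ⟨fun K => Limits.hasLimit_of_iso Discrete.natIsoFunctor.symm⟩
  let adj := evaluationAdjunctionLeft C (op s)
  have hR (c : C) : Presheaf.IsSheaf (alexandrov α) ((evaluationRightAdjoint C (op s)).obj c) := by
    intro E t S hS x hx
    refine ⟨skyLift s c fun g => x g (mem_of_cover hs g hS) ≫ skyProj s c (𝟙 s), ?_, ?_⟩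
    · intro V f hf
      change skyLift s c _ ≫ ((evaluationRightAdjoint C (op s)).obj c).map f.op = x f hf
      refine sky_ext fun g => ?_
      have h : x (g ≫ f) _ ≫ ((evaluationRightAdjoint C (op s)).obj c).map (𝟙 s).op =
          x f hf ≫ ((evaluationRightAdjoint C (op s)).obj c).map g.op :=
        hx (𝟙 s) g (mem_of_cover hs (g ≫ f) hS) hf (by simp)
      rw [op_id, CategoryTheory.Functor.map_id, Category.comp_id] at h
      rw [Category.assoc, sky_map, skyLift_proj, h, Category.assoc, sky_map, Category.id_comp]
    · intro y hy
      refine sky_ext fun g => ?_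
      have h : y ≫ ((evaluationRightAdjoint C (op s)).obj c).map g.op = x g _ :=
        hy g (mem_of_cover hs g hS)
      rw [skyLift_proj, ← h, Category.assoc, sky_map, Category.id_comp]
  rw [isIso_iff_coyoneda_map_bijective]
  intro c
  have h1 := (alexandrov α).W_toSheafify P _ (hR c)
  have h2 := ((adj.homEquiv P c).symm.bijective.comp h1).comp (adj.homEquiv _ c).bijective
  refine (congrArg Function.Bijective (funext fun g => ?_)).mpr h2
  change _ = (adj.homEquiv P c).symm (toSheafify (alexandrov α) P ≫ adj.homEquiv _ c g)
  rw [Adjunction.homEquiv_naturality_left_symm]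
  simp


instance isIso_map_toSheafify {α : Ordinal.{w}} [HasWeakSheafify (alexandrov α) C]
    (P : (Stage α)ᵒᵖ ⥤ C) (F : C ⥤ C) :
    IsIso ((presheafToSheaf (alexandrov α) C).map
      (Functor.whiskerRight (toSheafify (alexandrov α) P) F)) :=
  isIso_map_of_succ _ fun s hs => by
    have := isIso_toSheafify_app P hs
    exact inferInstanceAs (IsIso (F.map ((toSheafify (alexandrov α) P).app (op s))))


section Extension

variable {α : Ordinal.{w}} [HasWeakSheafify (alexandrov α) C]

/-- The pointwise extension of an endofunctor `F` to sheaves: apply `F` at every stage and sheafify. -/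
noncomputable def extP (F : C ⥤ C) (α : Ordinal.{w}) [HasWeakSheafify (alexandrov α) C] :
    Sh C α ⥤ Sh C α :=
  sheafToPresheaf _ _ ⋙ (Functor.whiskeringRight _ _ _).obj F ⋙ presheafToSheaf _ _

/-- The pointwise extension of a natural transformation. -/
noncomputable def extPMap {F F' : C ⥤ C} (σ : F ⟶ F') (α : Ordinal.{w})
    [HasWeakSheafify (alexandrov α) C] : extP F α ⟶ extP F' α :=
  Functor.whiskerLeft (sheafToPresheaf _ _)
    (Functor.whiskerRight ((Functor.whiskeringRight _ _ _).map σ) (presheafToSheaf _ _))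

/-- For a presheaf `P`, the comparison of the sheafification of `P ⋙ F` with the pointwise extension
of `F` at the sheafification of `P`. -/
noncomputable def extPUnit (P : (Stage α)ᵒᵖ ⥤ C) (F : C ⥤ C) :
    (presheafToSheaf (alexandrov α) C).obj (P ⋙ F) ⟶
      (extP F α).obj ((presheafToSheaf (alexandrov α) C).obj P) :=
  (presheafToSheaf (alexandrov α) C).map
    (Functor.whiskerRight (toSheafify (alexandrov α) P) F)

/-- `extPUnit` is an isomorphism, because the unit of sheafification is one at successor stages. -/
noncomputable def extPUnitIso (P : (Stage α)ᵒᵖ ⥤ C) (F : C ⥤ C) :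
    (presheafToSheaf (alexandrov α) C).obj (P ⋙ F) ≅
      (extP F α).obj ((presheafToSheaf (alexandrov α) C).obj P) :=
  have : IsIso (extPUnit P F) := isIso_map_toSheafify P F
  asIso (extPUnit P F)

theorem extPUnit_naturality {P Q : (Stage α)ᵒᵖ ⥤ C} (f : P ⟶ Q) (F : C ⥤ C) :
    extPUnit P F ≫ (extP F α).map ((presheafToSheaf (alexandrov α) C).map f) =
      (presheafToSheaf (alexandrov α) C).map (Functor.whiskerRight f F) ≫ extPUnit Q F := by
  refine (Functor.map_comp _ _ _).symm.trans (Eq.trans ?_ (Functor.map_comp _ _ _))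
  refine congrArg _ ?_
  refine (Functor.whiskerRight_comp _ _ _).symm.trans (Eq.trans ?_ (Functor.whiskerRight_comp _ _ _))
  exact congrArg (fun k => Functor.whiskerRight k F) (toSheafify_naturality (alexandrov α) f).symm

theorem extPUnit_natural {F F' : C ⥤ C} (σ : F ⟶ F') (P : (Stage α)ᵒᵖ ⥤ C) :
    extPUnit P F ≫ (extPMap σ α).app ((presheafToSheaf (alexandrov α) C).obj P) =
      (presheafToSheaf (alexandrov α) C).map (Functor.whiskerLeft P σ) ≫ extPUnit P F' := by
  refine (Functor.map_comp _ _ _).symm.trans (Eq.trans ?_ (Functor.map_comp _ _ _))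
  refine congrArg _ ?_
  ext s
  exact (σ.naturality _)

/-- Pointwise extension respects composition up to canonical isomorphism. -/
noncomputable def extPComp (F F' : C ⥤ C) (α : Ordinal.{w}) [HasWeakSheafify (alexandrov α) C] :
    extP F' α ⋙ extP F α ≅ extP (F' ⋙ F) α :=
  (NatIso.ofComponents (F := extP (F' ⋙ F) α) (G := extP F' α ⋙ extP F α)
    (fun X => extPUnitIso (X.obj ⋙ F') F)
    (fun {X Y} (f : X ⟶ Y) => (extPUnit_naturality (Functor.whiskerRight f.hom F') F).symm)).symm

/-- Pointwise extension respects the identity up to canonical isomorphism. -/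
noncomputable def extPId (α : Ordinal.{w}) [HasWeakSheafify (alexandrov α) C] :
    𝟭 (Sh C α) ≅ extP (𝟭 C) α :=
  (asIso (sheafificationAdjunction (alexandrov α) C).counit).symm

theorem extPId_app (P : (Stage α)ᵒᵖ ⥤ C) :
    (extPId α).hom.app ((presheafToSheaf (alexandrov α) C).obj P) =
      (presheafToSheaf (alexandrov α) C).map (toSheafify (alexandrov α) P) := by
  have h := (sheafificationAdjunction (alexandrov α) C).left_triangle_components P
  have h' := congrArg (fun k => k ≫ (extPId α).hom.app _) h
  have e : (sheafificationAdjunction (alexandrov α) C).counit.app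
      ((presheafToSheaf (alexandrov α) C).obj P) ≫ (extPId α).hom.app _ = 𝟙 _ :=
    (extPId (C := C) α).inv_hom_id_app _
  refine (Category.id_comp _).symm.trans (h'.symm.trans ?_)
  refine (Category.assoc _ _ _).trans ?_
  exact (congrArg _ e).trans (Category.comp_id _)

theorem extPUnit_counit (X : Sh C α) (F : C ⥤ C) :
    extPUnit X.obj F ≫ (extP F α).map ((extPId α).inv.app X) = 𝟙 _ := by
  have h := (sheafificationAdjunction (alexandrov α) C).right_triangle_components X
  refine (Functor.map_comp _ _ _).symm.trans (Eq.trans ?_ (CategoryTheory.Functor.map_id _ _))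
  refine congrArg _ ?_
  refine (Functor.whiskerRight_comp _ _ _).symm.trans (Eq.trans ?_ (Functor.whiskerRight_id' F))
  exact congrArg (fun k => Functor.whiskerRight k F) h

/-- The unit of the pointwise extension of a monad. -/
noncomputable def extPη (T : Monad C) (α : Ordinal.{w}) [HasWeakSheafify (alexandrov α) C] :
    𝟭 (Sh C α) ⟶ extP T.toFunctor α :=
  (extPId α).hom ≫ extPMap T.η α

/-- The multiplication of the pointwise extension of a monad. -/
noncomputable def extPμ (T : Monad C) (α : Ordinal.{w}) [HasWeakSheafify (alexandrov α) C] :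
    extP T.toFunctor α ⋙ extP T.toFunctor α ⟶ extP T.toFunctor α :=
  (extPComp T.toFunctor T.toFunctor α).hom ≫ extPMap T.μ α

theorem extPUnit_μ (T : Monad C) (X : Sh C α) :
    extPUnit (X.obj ⋙ T.toFunctor) T.toFunctor ≫ (extPμ T α).app X =
      (presheafToSheaf (alexandrov α) C).map (Functor.whiskerLeft X.obj T.μ) := by
  have e : extPUnit (X.obj ⋙ T.toFunctor) T.toFunctor ≫
      (extPComp T.toFunctor T.toFunctor α).hom.app X = 𝟙 _ :=
    (extPComp T.toFunctor T.toFunctor α).inv_hom_id_app X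
  refine (Category.assoc _ _ _).symm.trans ?_
  rw [e]
  exact Category.id_comp _

theorem extP_cancel {P : (Stage α)ᵒᵖ ⥤ C} {F : C ⥤ C} {Y : Sh C α}
    {f g : (extP F α).obj ((presheafToSheaf (alexandrov α) C).obj P) ⟶ Y}
    (h : extPUnit P F ≫ f = extPUnit P F ≫ g) : f = g :=
  have : IsIso (extPUnit P F) := isIso_map_toSheafify P F
  (cancel_epi (extPUnit P F)).1 h

theorem chase_assoc {D : Type*} [Category D] {A B B' G Z H K : D} {w₁ : A ⟶ B} {w₂ : B ⟶ B'}
    {m₁ : B' ⟶ G} {n₁ : B' ⟶ G} {m : G ⟶ Z} {k : B ⟶ G} {p q : A ⟶ H} {w : H ⟶ G} {r : H ⟶ Z}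
    {x : A ⟶ K} {y : K ⟶ B'} {z : K ⟶ G} (e₁ : w₂ ≫ m₁ = k) (e₂ : w₁ ≫ k = p ≫ w)
    (e₃ : w₁ ≫ w₂ = x ≫ y) (e₄ : w ≫ m = r) (e₅ : y ≫ n₁ = z) (e₆ : x ≫ z = q ≫ w)
    (e₇ : p ≫ r = q ≫ r) : w₁ ≫ w₂ ≫ m₁ ≫ m = w₁ ≫ w₂ ≫ n₁ ≫ m := by
  rw [reassoc_of% e₁, reassoc_of% e₂, e₄, e₇, reassoc_of% e₃, reassoc_of% e₅, reassoc_of% e₆, e₄]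

theorem chase_unit {D : Type*} [Category D] {A B G Z H : D} {w : A ⟶ B} {i : B ⟶ Z}
    {h : Z ⟶ G} {m : G ⟶ Z} {k : B ⟶ G} {p : A ⟶ H} {w' : H ⟶ G} {r : H ⟶ Z} {d : A ⟶ Z}
    (e₁ : i ≫ h = k) (e₂ : w ≫ k = p ≫ w') (e₃ : w' ≫ m = r) (e₄ : p ≫ r = d)
    (e₅ : w ≫ i = d) : w ≫ i ≫ h ≫ m = w ≫ i ≫ 𝟙 Z := by
  rw [reassoc_of% e₁, reassoc_of% e₂, e₃, e₄, Category.comp_id, e₅]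

theorem extPMonad_assoc (T : Monad C) (X : Sh C α) :
    (extP T.toFunctor α).map ((extPμ T α).app X) ≫ (extPμ T α).app X =
      (extPμ T α).app ((extP T.toFunctor α).obj X) ≫ (extPμ T α).app X := by
  let a := presheafToSheaf (alexandrov α) C
  let t := T.toFunctor
  let E := extP t α
  let P := X.obj
  have hE : Epi (E.map (extPUnit (P ⋙ t) t)) :=
    inferInstanceAs (Epi (E.mapIso (extPUnitIso (P ⋙ t) t)).hom)
  refine hE.left_cancellation _ _ (extP_cancel ?_)
  have e1 : E.map (extPUnit (P ⋙ t) t) ≫ E.map ((extPμ T α).app X) =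
      E.map (a.map (Functor.whiskerLeft P T.μ)) :=
    (E.map_comp _ _).symm.trans (congrArg _ (extPUnit_μ T X))
  have e2 : extPUnit ((P ⋙ t) ⋙ t) t ≫ E.map (a.map (Functor.whiskerLeft P T.μ)) =
      a.map (Functor.whiskerRight (Functor.whiskerLeft P T.μ) t) ≫ extPUnit (P ⋙ t) t :=
    extPUnit_naturality _ _
  have e3 : extPUnit ((P ⋙ t) ⋙ t) t ≫ E.map (extPUnit (P ⋙ t) t) =
      a.map (Functor.whiskerRight (Functor.whiskerRight (toSheafify (alexandrov α) (P ⋙ t)) t) t) ≫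
        extPUnit ((a.obj (P ⋙ t)).obj ⋙ t) t :=
    extPUnit_naturality _ _
  have e4 := extPUnit_μ T X
  have e5 : extPUnit ((a.obj (P ⋙ t)).obj ⋙ t) t ≫ (extPμ T α).app (E.obj X) =
      a.map (Functor.whiskerLeft (a.obj (P ⋙ t)).obj T.μ) := extPUnit_μ T (E.obj X)
  have e6 : Functor.whiskerRight (Functor.whiskerRight
        (toSheafify (alexandrov α) (P ⋙ t)) t) t ≫
        Functor.whiskerLeft (a.obj (P ⋙ t)).obj T.μ =
      Functor.whiskerLeft (P ⋙ t) T.μ ≫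
        Functor.whiskerRight (toSheafify (alexandrov α) (P ⋙ t)) t := by
    ext s
    exact T.μ.naturality _
  have e7 : Functor.whiskerRight (Functor.whiskerLeft P T.μ) t ≫ Functor.whiskerLeft P T.μ =
      Functor.whiskerLeft (P ⋙ t) T.μ ≫ Functor.whiskerLeft P T.μ := by
    ext s
    exact T.assoc _
  exact chase_assoc e1 e2 e3 e4 e5
    ((a.map_comp _ _).symm.trans ((congrArg _ e6).trans (a.map_comp _ _)))
    ((a.map_comp _ _).symm.trans ((congrArg _ e7).trans (a.map_comp _ _)))

theorem extPMonad_left_unit (T : Monad C) (X : Sh C α) :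
    (extPη T α).app ((extP T.toFunctor α).obj X) ≫ (extPμ T α).app X =
      𝟙 ((extP T.toFunctor α).obj X) := by
  let a := presheafToSheaf (alexandrov α) C
  let t := T.toFunctor
  let P := X.obj
  have e1 : (extPη T α).app ((extP t α).obj X) =
      a.map (Functor.whiskerLeft (P ⋙ t) T.η) ≫ extPUnit (P ⋙ t) t := by
    refine (congrArg (fun k => k ≫ (extPMap T.η α).app _) (extPId_app (P ⋙ t))).trans ?_
    exact extPUnit_natural T.η (P ⋙ t)
  have e2 : Functor.whiskerLeft (P ⋙ t) T.η ≫ Functor.whiskerLeft P T.μ = 𝟙 (P ⋙ t) := by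
    ext s
    exact T.left_unit _
  rw [e1]
  refine (Category.assoc _ _ _).trans ((congrArg _ (extPUnit_μ T X)).trans ?_)
  exact (a.map_comp _ _).symm.trans ((congrArg _ e2).trans (a.map_id _))

theorem extPMonad_right_unit (T : Monad C) (X : Sh C α) :
    (extP T.toFunctor α).map ((extPη T α).app X) ≫ (extPμ T α).app X =
      𝟙 ((extP T.toFunctor α).obj X) := by
  let a := presheafToSheaf (alexandrov α) C
  let t := T.toFunctor
  let E := extP t α
  let P := X.obj
  have hE : Epi (E.map ((extPId α).inv.app X)) :=
    inferInstanceAs (Epi (E.mapIso ((extPId α).app X).symm).hom)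
  refine hE.left_cancellation _ _ (extP_cancel (P := P) ?_)
  have e1 : E.map ((extPId α).inv.app X) ≫ E.map ((extPη T α).app X) =
      E.map (a.map (Functor.whiskerLeft P T.η)) := by
    refine (E.map_comp _ _).symm.trans (congrArg _ ?_)
    refine (Category.assoc _ _ _).symm.trans ?_
    refine (congrArg (fun k => k ≫ (extPMap T.η α).app X) ((extPId α).inv_hom_id_app X)).trans ?_
    exact Category.id_comp _
  have e2 : extPUnit P t ≫ E.map (a.map (Functor.whiskerLeft P T.η)) =
      a.map (Functor.whiskerRight (Functor.whiskerLeft P T.η) t) ≫ extPUnit (P ⋙ t) t :=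
    extPUnit_naturality (Functor.whiskerLeft P T.η) t
  have e3 : Functor.whiskerRight (Functor.whiskerLeft P T.η) t ≫ Functor.whiskerLeft P T.μ =
      𝟙 (P ⋙ t) := by
    ext s
    exact T.right_unit _
  exact chase_unit e1 e2 (extPUnit_μ T X)
    ((a.map_comp _ _).symm.trans ((congrArg _ e3).trans (a.map_id _))) (extPUnit_counit X t)

/-- The pointwise extension of a monad on `C` to a monad on sheaves. -/
noncomputable def extPMonad (T : Monad C) (α : Ordinal.{w}) [HasWeakSheafify (alexandrov α) C] :
    Monad (Sh C α) where
  toFunctor := extP T.toFunctor α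
  η := extPη T α
  μ := extPμ T α
  assoc X := extPMonad_assoc T X
  left_unit X := extPMonad_left_unit T X
  right_unit X := extPMonad_right_unit T X

/-- The later endofunctor: precompose with the predecessor and sheafify. -/
noncomputable def later (C : Type u) [Category.{v} C] (α : Ordinal.{w})
    [HasWeakSheafify (alexandrov α) C] : Sh C α ⥤ Sh C α :=
  sheafToPresheaf _ _ ⋙
    (Functor.whiskeringLeft _ _ _).obj (predecessor α).monotone.functor.op ⋙ presheafToSheaf _ _

/-- Restriction of a presheaf from each stage to its predecessor. -/
noncomputable def restrictPredecessor (P : (Stage α)ᵒᵖ ⥤ C) :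
    P ⟶ (predecessor α).monotone.functor.op ⋙ P where
  app s := P.map (homOfLE (predecessor_le s.unop)).op
  naturality _ _ _ := (P.map_comp _ _).symm.trans
    ((congrArg P.map (Subsingleton.elim _ _)).trans (P.map_comp _ _))

/-- The natural transformation from the identity to the later endofunctor, by restriction. -/
noncomputable def next (C : Type u) [Category.{v} C] (α : Ordinal.{w})
    [HasWeakSheafify (alexandrov α) C] : 𝟭 (Sh C α) ⟶ later C α where
  app X := ⟨restrictPredecessor X.obj ≫
    toSheafify (alexandrov α) ((predecessor α).monotone.functor.op ⋙ X.obj)⟩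
  naturality X Y f := by
    apply ObjectProperty.hom_ext
    have h : f.hom ≫ restrictPredecessor Y.obj = restrictPredecessor X.obj ≫
        Functor.whiskerLeft (predecessor α).monotone.functor.op f.hom := by
      ext s
      exact (f.hom.naturality _).symm
    have h' := toSheafify_naturality (alexandrov α)
      (Functor.whiskerLeft (predecessor α).monotone.functor.op f.hom)
    change f.hom ≫ restrictPredecessor Y.obj ≫ toSheafify _ _ =
      (restrictPredecessor X.obj ≫ toSheafify _ _) ≫ sheafifyMap _ _
    rw [reassoc_of% h, h', Category.assoc]
    rfl

/-- The guarded pointwise extension of `F`: the later endofunctor followed by the pointwise extension. -/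
noncomputable def guarded (F : C ⥤ C) (α : Ordinal.{w}) [HasWeakSheafify (alexandrov α) C] :
    Sh C α ⥤ Sh C α :=
  later C α ⋙ extP F α

/-- The canonical map from `F (X (p s))`, with `p` the predecessor, to the guarded pointwise extension
of `F` at `X`, both at stage `s`: the unit of sheafification is applied twice. -/
noncomputable def guardedUnit (F : C ⥤ C) (X : Sh C α) :
    ((predecessor α).monotone.functor.op ⋙ X.obj) ⋙ F ⟶ ((guarded F α).obj X).obj :=
  Functor.whiskerRight (toSheafify (alexandrov α) _) F ≫ toSheafify (alexandrov α) _

end Extension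

/-- A final sequence of `F`: a limit preserving functor from the opposite of the ordinals to `C` whose
value at `β + 1` is `F` of its value at `β` (and likewise on restriction maps). Limit preservation is
the sheaf condition for the sup topology: the value at `0` is terminal and the value at a limit
ordinal is the limit of the values below it. -/
structure FinalSequence (F : C ⥤ C) where
  seq : Ordinal.{w}ᵒᵖ ⥤ C
  isSheaf : Presheaf.IsSheaf (supTopology Ordinal.{w}) seq
  succIso (β : Ordinal.{w}) : seq.obj (op (β + 1)) ≅ F.obj (seq.obj (op β))
  succIso_naturality {β γ : Ordinal.{w}} (h : β ≤ γ) (h' : β + 1 ≤ γ + 1) :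
    seq.map (homOfLE h').op ≫ (succIso β).hom = (succIso γ).hom ≫ F.map (seq.map (homOfLE h).op)

namespace FinalSequence

variable {F : C ⥤ C} (Φ : FinalSequence.{w} F)

theorem le_add_one (α : Ordinal.{w}) : α ≤ α + 1 := by simp

/-- The final sequence is stable at `α` when its restriction from `α + 1` to `α` is an isomorphism. -/
def IsStableAt (α : Ordinal.{w}) : Prop :=
  IsIso (Φ.seq.map (homOfLE (le_add_one α)).op)

/-- The `F`-coalgebra carried by the value at `α` of a final sequence that is stable at `α`. -/
noncomputable def coalgebra (α : Ordinal.{w}) (h : Φ.IsStableAt α) : Endofunctor.Coalgebra F where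
  V := Φ.seq.obj (op α)
  str :=
    have : IsIso (Φ.seq.map (homOfLE (le_add_one α)).op) := h
    inv (Φ.seq.map (homOfLE (le_add_one α)).op) ≫ (Φ.succIso α).hom

/-- The inclusion of the stages of `α` into all ordinals. -/
def stageInclusion (α : Ordinal.{w}) : Stage α ⥤ Ordinal.{w} :=
  (Subtype.mono_coe (· ∈ Set.Iic α)).functor

theorem isSheaf_restrict (α : Ordinal.{w}) :
    Presheaf.IsSheaf (alexandrov α) ((stageInclusion α).op ⋙ Φ.seq) := by
  intro E t S hS
  let S' : Sieve t.1 :=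
    { arrows := fun b f => S (homOfLE (leOfHom f) : (⟨b, (leOfHom f).trans t.2⟩ : Stage α) ⟶ t)
      downward_closed := by
        intro b c f hf g
        exact S.downward_closed hf (homOfLE (leOfHom g) :
          (⟨c, (leOfHom (g ≫ f)).trans t.2⟩ : Stage α) ⟶ ⟨b, (leOfHom f).trans t.2⟩) }
  have hS' : S' ∈ supTopology Ordinal.{w} t.1 := by
    refine ⟨fun _ ⟨f, _⟩ => leOfHom f, fun x hx => ?_⟩
    by_contra hlt
    rw [not_le] at hlt
    have := hS.2 (show (⟨x, hlt.le.trans t.2⟩ : Stage α) ∈ _ from fun b ⟨g, hg⟩ =>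
      show b.1 ≤ x from hx ⟨homOfLE (show b.1 ≤ t.1 from leOfHom g), hg⟩)
    exact absurd (show t.1 ≤ x from this) (not_le.2 hlt)
  intro x hx
  let x' : Presieve.FamilyOfElements (Φ.seq ⋙ coyoneda.obj (op E)) S'.arrows :=
    fun b f hf => x (homOfLE (leOfHom f) : (⟨b, (leOfHom f).trans t.2⟩ : Stage α) ⟶ t) hf
  have hx' : x'.Compatible := by
    intro b c d g₁ g₂ f₁ f₂ h₁ h₂ _
    exact hx (Z := ⟨d, (leOfHom (g₁ ≫ f₁)).trans t.2⟩)
      (homOfLE (leOfHom g₁) : (⟨d, _⟩ : Stage α) ⟶ ⟨b, (leOfHom f₁).trans t.2⟩)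
      (homOfLE (leOfHom g₂) : (⟨d, _⟩ : Stage α) ⟶ ⟨c, (leOfHom f₂).trans t.2⟩) h₁ h₂
      (Subsingleton.elim _ _)
  obtain ⟨y, hy, hy'⟩ := Φ.isSheaf E S' hS' x' hx'
  exact ⟨y, fun b f hf => hy (homOfLE (show b.1 ≤ t.1 from leOfHom f)) hf,
    fun z hz => hy' z fun b f hf => hz _ hf⟩

/-- The sheaf on `α` given by a final sequence. -/
def sheaf (α : Ordinal.{w}) : Sh C α :=
  ⟨(stageInclusion α).op ⋙ Φ.seq, Φ.isSheaf_restrict α⟩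

/-- The identification, at stage `β + 1`, of the final sequence with `F` applied to its value at the
predecessor of that stage (which is `β`). -/
noncomputable def stageStr (α β : Ordinal.{w}) (h : β + 1 ≤ α) :
    (Φ.sheaf α).obj.obj (op ⟨β + 1, h⟩) ⟶
      (((predecessor α).monotone.functor.op ⋙ (Φ.sheaf α).obj) ⋙ F).obj (op ⟨β + 1, h⟩) :=
  (Φ.succIso β).hom ≫ F.map (Φ.seq.map (homOfLE (predecessor_succ h).le).op)

end FinalSequence

/-- A Kleisli lifting of an endofunctor `G` along a monad `T`: an endofunctor of the Kleisli category
that extends `G` along the canonical inclusion `K`. The comparison is an isomorphism; a strict lifting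
is the case of an identity. -/
structure KleisliLifting {D : Type*} [Category D] (T : Monad D) (G : D ⥤ D) where
  functor : Kleisli T ⥤ Kleisli T
  iso : Kleisli.Adjunction.toKleisli T ⋙ functor ≅ G ⋙ Kleisli.Adjunction.toKleisli T

namespace KleisliLifting

variable {D : Type*} [Category D] {T : Monad D} {G : D ⥤ D} (L : KleisliLifting T G)

/-- The image of a `G`-coalgebra under `K`. -/
def lift (Z : Endofunctor.Coalgebra G) : Endofunctor.Coalgebra L.functor where
  V := (Kleisli.Adjunction.toKleisli T).obj Z.V
  str := (Kleisli.Adjunction.toKleisli T).map Z.str ≫ L.iso.inv.app Z.V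

/-- A `TG`-coalgebra as a coalgebra for the Kleisli lifting of `G`. -/
def ofTG (X : Endofunctor.Coalgebra (G ⋙ T.toFunctor)) : Endofunctor.Coalgebra L.functor where
  V := (Kleisli.Adjunction.toKleisli T).obj X.V
  str := (⟨X.str⟩ : Kleisli.Hom ((Kleisli.Adjunction.toKleisli T).obj X.V)
    ((Kleisli.Adjunction.toKleisli T).obj (G.obj X.V))) ≫ L.iso.inv.app X.V

/-- The final coalgebra of the lifting exists and is the image under `K` of the final `G`-coalgebra. -/
def CapturesInfiniteTraceSemantics : Prop :=
  ∃ (Z : Endofunctor.Coalgebra G) (W : Endofunctor.Coalgebra L.functor),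
    Nonempty (Limits.IsTerminal Z) ∧ Nonempty (Limits.IsTerminal W) ∧ Nonempty (W ≅ L.lift Z)

end KleisliLifting

section Embedding

variable {α : Ordinal.{w}} [HasWeakSheafify (alexandrov α) C]

/-- The canonical map from the constant sheaf at `F X` to the pointwise extension of `F` at the
constant sheaf at `X`. -/
noncomputable def constToExtP (F : C ⥤ C) (α : Ordinal.{w}) [HasWeakSheafify (alexandrov α) C]
    (X : C) : (constantSheaf (alexandrov α) C).obj (F.obj X) ⟶
      (extP F α).obj ((constantSheaf (alexandrov α) C).obj X) :=
  (presheafToSheaf (alexandrov α) C).map ((Functor.constComp (Stage α)ᵒᵖ X F).inv ≫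
    Functor.whiskerRight (toSheafify (alexandrov α) ((Functor.const _).obj X)) F)

/-- The guarded coalgebra on the constant sheaf at `X` of a `TF`-coalgebra `h : X ⟶ T F X`: the constant
sheaf functor at `h`, followed by the pointwise extension of `TF` at `next`. -/
noncomputable def guardedCoalgebra (T : Monad C) (F : C ⥤ C) (α : Ordinal.{w})
    [HasWeakSheafify (alexandrov α) C] (X : Endofunctor.Coalgebra (F ⋙ T.toFunctor)) :
    Endofunctor.Coalgebra (guarded F α ⋙ (extPMonad T α).toFunctor) where
  V := (constantSheaf (alexandrov α) C).obj X.V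
  str := (constantSheaf (alexandrov α) C).map X.str ≫
    constToExtP (F ⋙ T.toFunctor) α X.V ≫
    (extP (F ⋙ T.toFunctor) α).map ((next C α).app ((constantSheaf (alexandrov α) C).obj X.V)) ≫
    (extPComp T.toFunctor F α).inv.app ((later C α).obj ((constantSheaf (alexandrov α) C).obj X.V))

end Embedding

end GuardedTrace

open GuardedTrace

namespace GuardedTrace

variable {C : Type u} [Category.{v} C]

/-! Successor stages cover every stage, so a map into a sheaf is determined by its values there. At
a successor stage `t` the unit of sheafification is invertible, hence `guarded E α` at `X` is `E` of
the value of `X` at the predecessor, which is strictly below `t`. An equation `h = c ≫ (guarded E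
α).map h ≫ m` therefore computes `h` at `t` from `h` at an earlier stage. Well-founded recursion
gives exactly one solution for any `c` and `m` (`existsUnique_of_step`, `existsUnique_guarded`).

All the finality claims are instances of this recursion. For `G`, take `m` inverse to the structure
`c` of the final sequence. For a Kleisli lifting, every Kleisli morphism is `K` of its underlying
map followed by a counit, so the lifting acts on it through `G` and a fixed map (`functor_map_eq`).
The homomorphism condition then becomes a recursion for `T` after `G`, which is again guarded, being
isomorphic to the guarded extension of `F ⋙ T`. For `F`, stability identifies homomorphisms into the
value at `α` with cones over the stages that satisfy the same kind of recursion. -/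

/-! ### Successor stages as a base of the site -/

theorem predecessor_lt {α : Ordinal.{w}} {t : Stage α} (ht : IsSuccStage α t) :
    predecessor α t < t := by
  obtain ⟨t, h⟩ := t
  obtain ⟨β, rfl : t = β + 1⟩ := ht
  exact (predecessor_succ (Set.mem_Iic.1 h)).trans_lt (Order.lt_add_one_iff.2 le_rfl)

theorem predecessor_add_one {α : Ordinal.{w}} {t : Stage α} (ht : IsSuccStage α t) :
    (predecessor α t).1 + 1 = t.1 := by
  obtain ⟨t, h⟩ := t
  obtain ⟨β, rfl : t = β + 1⟩ := ht
  exact congrArg (· + 1) (predecessor_succ (Set.mem_Iic.1 h))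

/-- The successor stages below `s` cover `s`. -/
theorem generate_succ_mem {α : Ordinal.{w}} (s : Stage α) :
    Sieve.generate (fun t (_ : t ⟶ s) => IsSuccStage α t) ∈ alexandrov α s := by
  refine GrothendieckTopology.superset_covering _ ?_
    (Functor.is_cover_of_isCoverDense (IsSuccStage α).ι (alexandrov α) s)
  rintro r _ ⟨⟨t, f, g, _⟩⟩
  exact ⟨_, f, g, t.property, Subsingleton.elim _ _⟩

/-- The sheaf condition for the cover by successor stages. Stages are linearly ordered, so
compatibility only has to be required along `t ≤ t'`, not on arbitrary common refinements. -/
theorem existsUnique_amalgamation {α : Ordinal.{w}} {Y : (Stage α)ᵒᵖ ⥤ C}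
    (hY : Presheaf.IsSheaf (alexandrov α) Y) (s : Stage α) (A : C)
    (x : ∀ t ≤ s, IsSuccStage α t → (A ⟶ Y.obj (op t)))
    (hx : ∀ t t' (h : t ≤ t') (hs : t' ≤ s) (ht : IsSuccStage α t) (ht' : IsSuccStage α t'),
      x t' hs ht' ≫ Y.map (homOfLE h).op = x t (h.trans hs) ht) :
    ∃! k : A ⟶ Y.obj (op s), ∀ t (h : t ≤ s) (ht : IsSuccStage α t),
      k ≫ Y.map (homOfLE h).op = x t h ht := by
  have hS := (Presieve.isSheafFor_iff_generate _).2 (hY A _ (generate_succ_mem s))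
  obtain ⟨k, hk, hk'⟩ := hS (fun t f ht => x t (leOfHom f) ht) (by
    intro t₁ t₂ r g₁ g₂ f₁ f₂ h₁ h₂ _
    change x t₁ _ h₁ ≫ Y.map g₁.op = x t₂ _ h₂ ≫ Y.map g₂.op
    rcases le_total t₁ t₂ with h | h
    · rw [← hx t₁ t₂ h (leOfHom f₂) h₁ h₂, Category.assoc, ← Y.map_comp]
      rfl
    · rw [← hx t₂ t₁ h (leOfHom f₁) h₂ h₁, Category.assoc, ← Y.map_comp]
      rfl)
  exact ⟨k, fun t h ht => hk (homOfLE h) ht, fun k' h => hk' k' fun t f ht => h t (leOfHom f) ht⟩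

theorem hom_ext_of_succ {α : Ordinal.{w}} {Y : (Stage α)ᵒᵖ ⥤ C}
    (hY : Presheaf.IsSheaf (alexandrov α) Y) {s : Stage α} {A : C} {k k' : A ⟶ Y.obj (op s)}
    (h : ∀ t (h : t ≤ s), IsSuccStage α t →
      k ≫ Y.map (homOfLE h).op = k' ≫ Y.map (homOfLE h).op) : k = k' :=
  (existsUnique_amalgamation hY s A (fun t h _ => k' ≫ Y.map (homOfLE h).op)
    (fun t t' h hs _ _ => by rw [Category.assoc, ← Y.map_comp]; rfl)).unique h
      fun _ _ _ => rfl

theorem natTrans_ext_of_succ {α : Ordinal.{w}} {Z Y : (Stage α)ᵒᵖ ⥤ C}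
    (hY : Presheaf.IsSheaf (alexandrov α) Y) {f g : Z ⟶ Y}
    (h : ∀ t, IsSuccStage α t → f.app (op t) = g.app (op t)) : f = g := by
  ext s
  refine hom_ext_of_succ hY fun t hts ht => ?_
  rw [← f.naturality, ← g.naturality, h t ht]

/-! ### Recursion along predecessors -/

section Step

variable {α : Ordinal.{w}} {Z Y : (Stage α)ᵒᵖ ⥤ C}
  (step : ∀ t, IsSuccStage α t →
    (Z.obj (op (predecessor α t)) ⟶ Y.obj (op (predecessor α t))) →
      (Z.obj (op t) ⟶ Y.obj (op t)))

/-- A family of maps at the stages up to `s` that follows the recursion `step`. -/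
def IsAttempt (s : Stage α) (h : ∀ r ≤ s, Z.obj (op r) ⟶ Y.obj (op r)) : Prop :=
  ∀ r (hr : r ≤ s) t (htr : t ≤ r) (ht : IsSuccStage α t),
    h r hr ≫ Y.map (homOfLE htr).op = Z.map (homOfLE htr).op ≫
      step t ht (h _ ((predecessor_le t).trans (htr.trans hr)))

variable {step}

/-- This is the case `t = r` of the defining condition. The cases `t < r` are what pins down the
value at a limit stage, through its restrictions to the successors below. -/
theorem IsAttempt.apply_succ {s : Stage α} {h : ∀ r ≤ s, Z.obj (op r) ⟶ Y.obj (op r)}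
    (H : IsAttempt step s h) {t : Stage α} (hts : t ≤ s) (ht : IsSuccStage α t) :
    h t hts = step t ht (h _ ((predecessor_le t).trans hts)) := by
  have := H t hts t le_rfl ht
  have e : (homOfLE (le_refl t)).op = 𝟙 (op t) := rfl
  rwa [e, Y.map_id, Z.map_id, Category.comp_id, Category.id_comp] at this

theorem IsAttempt.mono {s s' : Stage α} {h : ∀ r ≤ s, Z.obj (op r) ⟶ Y.obj (op r)}
    (H : IsAttempt step s h) (hs : s' ≤ s) : IsAttempt step s' fun r hr => h r (hr.trans hs) :=
  fun r hr t htr ht => H r (hr.trans hs) t htr ht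

/-- The value at `r` is fixed by its restrictions to successors `t ≤ r`, and these only consult the
predecessor of `t`, which lies strictly below `r`. Hence one well-founded induction handles zero,
successors and limits alike. -/
theorem IsAttempt.eq (hY : Presheaf.IsSheaf (alexandrov α) Y) {s : Stage α}
    {h h' : ∀ r ≤ s, Z.obj (op r) ⟶ Y.obj (op r)} (H : IsAttempt step s h)
    (H' : IsAttempt step s h') (r : Stage α) (hr : r ≤ s) : h r hr = h' r hr := by
  induction r using WellFoundedLT.induction with
  | ind r ih =>
    refine hom_ext_of_succ hY fun t htr ht => ?_
    rw [H r hr t htr ht, H' r hr t htr ht, ih _ ((predecessor_lt ht).trans_le htr)]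

/-- On each successor `t ≤ r` both sides restrict to the same map out of `Z`, restriction to `t`
followed by `step`, so no induction is needed. -/
theorem IsAttempt.naturality (hY : Presheaf.IsSheaf (alexandrov α) Y) {s : Stage α}
    {h : ∀ r ≤ s, Z.obj (op r) ⟶ Y.obj (op r)} (H : IsAttempt step s h) {r r' : Stage α}
    (hr : r ≤ r') (hr' : r' ≤ s) :
    h r' hr' ≫ Y.map (homOfLE hr).op = Z.map (homOfLE hr).op ≫ h r (hr.trans hr') := by
  refine hom_ext_of_succ hY fun t htr ht => ?_
  rw [Category.assoc, Category.assoc, H r (hr.trans hr') t htr ht, ← Y.map_comp,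
    ← Category.assoc, ← Z.map_comp]
  exact H r' hr' t (htr.trans hr) ht

variable
  (hstep : ∀ t t' (h : t ≤ t') (ht : IsSuccStage α t) (ht' : IsSuccStage α t') k k',
    k' ≫ Y.map (homOfLE ((predecessor α).monotone h)).op =
      Z.map (homOfLE ((predecessor α).monotone h)).op ≫ k →
    step t' ht' k' ≫ Y.map (homOfLE h).op = Z.map (homOfLE h).op ≫ step t ht k)

-- Earlier attempts agree by uniqueness and combine into one family below `s`. Applying `step` to it
-- at each successor up to `s` gives a family that `hstep` makes compatible, and its amalgamation is
-- the value at `s`.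
include hstep in
theorem exists_isAttempt (hY : Presheaf.IsSheaf (alexandrov α) Y) (s : Stage α) :
    ∃ h, IsAttempt step s h := by
  induction s using WellFoundedLT.induction with
  | ind s ih =>
    choose a ha using ih
    -- The diagonal of the chosen attempts; by `IsAttempt.eq` it agrees with every one of them
    -- wherever both are defined.
    let b (r : Stage α) (hr : r < s) : Z.obj (op r) ⟶ Y.obj (op r) := a r hr r le_rfl
    have hb (r r') (hr : r ≤ r') (hs : r' < s) : a r' hs r hr = b r (hr.trans_lt hs) :=
      ((ha r' hs).mono hr).eq hY (ha r _) r le_rfl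
    have hb' (r : Stage α) (hr : r < s) t (htr : t ≤ r) (ht : IsSuccStage α t) :
        b r hr ≫ Y.map (homOfLE htr).op = Z.map (homOfLE htr).op ≫
          step t ht (b _ ((predecessor_le t).trans_lt (htr.trans_lt hr))) := by
      rw [← hb _ r ((predecessor_le t).trans htr) hr]
      exact ha r hr r le_rfl t htr ht
    have hnat (r r') (hr : r ≤ r') (hs : r' < s) :
        b r' hs ≫ Y.map (homOfLE hr).op = Z.map (homOfLE hr).op ≫ b r (hr.trans_lt hs) := by
      rw [← hb r r' hr hs]
      exact (ha r' hs).naturality hY hr le_rfl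
    obtain ⟨k, hk, -⟩ := existsUnique_amalgamation hY s (Z.obj (op s))
      (fun t hts ht => Z.map (homOfLE hts).op ≫
        step t ht (b _ ((predecessor_lt ht).trans_le hts))) (by
      intro t t' h hs ht ht'
      rw [Category.assoc, hstep t t' h ht ht' _ _ (hnat _ _ _ _), ← Category.assoc, ← Z.map_comp]
      rfl)
    classical
    refine ⟨fun r hr => if h : r = s then eqToHom (by rw [h]) ≫ k ≫ eqToHom (by rw [h])
      else b r (lt_of_le_of_ne hr h), ?_⟩
    intro r hr t htr ht
    -- Even when `r = s`, the predecessor of `t` is strictly below `s`, so the recursion only reads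
    -- `b`, never the new value `k`.
    simp only [dif_neg ((predecessor_lt ht).trans_le (htr.trans hr)).ne]
    split_ifs with h
    · subst h
      rw [eqToHom_refl, eqToHom_refl, Category.id_comp, Category.comp_id]
      exact hk t htr ht
    · exact hb' r _ t htr ht

include hstep in
/-- Guarded recursion: a map into a sheaf can be defined by specifying its value at a successor stage
in terms of its value at the predecessor of that stage. -/
theorem existsUnique_of_step (hY : Presheaf.IsSheaf (alexandrov α) Y) :
    ∃! h : Z ⟶ Y, ∀ t (ht : IsSuccStage α t),
      h.app (op t) = step t ht (h.app (op (predecessor α t))) := by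
  -- An attempt up to the largest stage `α` is defined at every stage.
  obtain ⟨a, ha⟩ := exists_isAttempt hstep hY ⟨α, Set.mem_Iic.2 le_rfl⟩
  refine ⟨{ app := fun s => a s.unop s.unop.2, naturality := ?_ }, ?_, ?_⟩
  · intro r' r f
    exact (ha.naturality hY (leOfHom f.unop) r'.unop.2).symm
  · exact fun t ht => ha.apply_succ _ ht
  · intro g hg
    -- Naturality makes any solution an attempt, so uniqueness of attempts applies.
    have H : IsAttempt step ⟨α, Set.mem_Iic.2 le_rfl⟩ fun r _ => g.app (op r) := by
      intro r hr t htr ht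
      rw [← g.naturality, hg t ht]
    ext s
    exact H.eq hY ha s.unop s.unop.2

end Step

/-! ### Guarded extensions and their fixed-point equations -/

section Guarded

variable {α : Ordinal.{w}} [HasWeakSheafify (alexandrov α) C]

theorem guardedUnit_naturality (E : C ⥤ C) {X Y : Sh C α} (f : X ⟶ Y) (t : Stage α) :
    E.map (f.hom.app (op (predecessor α t))) ≫ (guardedUnit E Y).app (op t) =
      (guardedUnit E X).app (op t) ≫ ((guarded E α).map f).hom.app (op t) := by
  have h₁ := toSheafify_naturality (alexandrov α)
    (Functor.whiskerLeft (predecessor α).monotone.functor.op f.hom)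
  have h₂ := toSheafify_naturality (alexandrov α) (Functor.whiskerRight ((later C α).map f).hom E)
  have e₁ := congrArg E.map (congr_app h₁ (op t))
  have e₂ := congr_app h₂ (op t)
  have e₃ := (E.map_comp _ _).symm.trans (e₁.trans (E.map_comp _ _))
  refine (Category.assoc _ _ _).symm.trans ?_
  refine (congrArg (fun k => k ≫ (toSheafify (alexandrov α) _).app (op t)) e₃).trans ?_
  refine (Category.assoc _ _ _).trans (Eq.trans ?_ (Category.assoc _ _ _).symm)
  exact congrArg _ e₂

/-- At a successor stage `t` the guarded pointwise extension of `E` at `X` is `E` of the value of `X`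
at the predecessor of `t`. -/
noncomputable def guardedUnitIso (E : C ⥤ C) (X : Sh C α) {t : Stage α} (ht : IsSuccStage α t) :
    E.obj (X.obj.obj (op (predecessor α t))) ≅ ((guarded E α).obj X).obj.obj (op t) :=
  have h₁ := isIso_toSheafify_app ((predecessor α).monotone.functor.op ⋙ X.obj) ht
  have h₂ := isIso_toSheafify_app (((later C α).obj X).obj ⋙ E) ht
  (E.mapIso (@asIso _ _ _ _ _ h₁)).trans (@asIso _ _ _ _ _ h₂)

theorem guardedUnitIso_hom (E : C ⥤ C) (X : Sh C α) {t : Stage α} (ht : IsSuccStage α t) :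
    (guardedUnitIso E X ht).hom = (guardedUnit E X).app (op t) :=
  rfl

theorem guarded_map_app (E : C ⥤ C) {X Y : Sh C α} (f : X ⟶ Y) {t : Stage α}
    (ht : IsSuccStage α t) :
    ((guarded E α).map f).hom.app (op t) = (guardedUnitIso E X ht).inv ≫
      E.map (f.hom.app (op (predecessor α t))) ≫ (guardedUnitIso E Y ht).hom := by
  rw [Iso.eq_inv_comp, guardedUnitIso_hom, guardedUnitIso_hom]
  exact (guardedUnit_naturality E f t).symm

theorem guardedUnitIso_map (E : C ⥤ C) (X : Sh C α) {t t' : Stage α} (h : t ≤ t')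
    (ht : IsSuccStage α t) (ht' : IsSuccStage α t') :
    (guardedUnitIso E X ht').hom ≫ ((guarded E α).obj X).obj.map (homOfLE h).op =
      E.map (X.obj.map (homOfLE ((predecessor α).monotone h)).op) ≫
        (guardedUnitIso E X ht).hom :=
  ((guardedUnit E X).naturality (homOfLE h).op).symm

theorem guardedUnitIso_inv_map (E : C ⥤ C) (X : Sh C α) {t t' : Stage α} (h : t ≤ t')
    (ht : IsSuccStage α t) (ht' : IsSuccStage α t') :
    (guardedUnitIso E X ht').inv ≫ E.map (X.obj.map (homOfLE ((predecessor α).monotone h)).op) =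
      ((guarded E α).obj X).obj.map (homOfLE h).op ≫ (guardedUnitIso E X ht).inv := by
  rw [Iso.inv_comp_eq, ← Category.assoc, guardedUnitIso_map E X h ht ht', Category.assoc,
    Iso.hom_inv_id, Category.comp_id]

/-- Guarded recursion for coalgebra-to-algebra morphisms. -/
theorem existsUnique_guarded (E : C ⥤ C) {Z Y : Sh C α} (c : Z ⟶ (guarded E α).obj Z)
    (m : (guarded E α).obj Y ⟶ Y) : ∃! h : Z ⟶ Y, h = c ≫ (guarded E α).map h ≫ m := by
  -- Both sides are maps into the sheaf `Y`, so the equation may be tested at successor stages,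
  -- where `guarded_map_app` turns it into a recursion on the predecessor.
  have key (h : Z ⟶ Y) : h = c ≫ (guarded E α).map h ≫ m ↔ ∀ t (ht : IsSuccStage α t),
      h.hom.app (op t) = c.hom.app (op t) ≫ (guardedUnitIso E Z ht).inv ≫
        E.map (h.hom.app (op (predecessor α t))) ≫ (guardedUnitIso E Y ht).hom ≫
          m.hom.app (op t) := by
    have e (t) (ht : IsSuccStage α t) : (c ≫ (guarded E α).map h ≫ m).hom.app (op t) =
        c.hom.app (op t) ≫ (guardedUnitIso E Z ht).inv ≫
        E.map (h.hom.app (op (predecessor α t))) ≫ (guardedUnitIso E Y ht).hom ≫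
          m.hom.app (op t) := by
      change c.hom.app (op t) ≫ ((guarded E α).map h).hom.app (op t) ≫ m.hom.app (op t) = _
      rw [guarded_map_app E h ht, Category.assoc, Category.assoc]
    constructor
    · intro h' t ht
      exact (congrArg (fun k : Z ⟶ Y => k.hom.app (op t)) h').trans (e t ht)
    · intro h'
      apply ObjectProperty.hom_ext
      exact natTrans_ext_of_succ Y.property fun t ht => (h' t ht).trans (e t ht).symm
  obtain ⟨h, hh, hu⟩ := existsUnique_of_step (Z := Z.obj) (Y := Y.obj)
    (step := fun t ht k => c.hom.app (op t) ≫ (guardedUnitIso E Z ht).inv ≫ E.map k ≫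
      (guardedUnitIso E Y ht).hom ≫ m.hom.app (op t)) (by
    intro t t' h ht ht' k k' e
    simp only [Category.assoc]
    rw [← m.hom.naturality, reassoc_of% guardedUnitIso_map E Y h ht ht', ← E.map_comp_assoc, e,
      E.map_comp_assoc, reassoc_of% guardedUnitIso_inv_map E Z h ht ht', ← Category.assoc,
      ← c.hom.naturality, Category.assoc]) Y.property
  exact ⟨⟨h⟩, (key _).2 hh, fun g hg => ObjectProperty.hom_ext _ (hu g.hom ((key g).1 hg))⟩

/-- Needed because the pointwise extension of `T` after `guarded F α` is a guarded extension only up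
to the isomorphism `guardedComp`. -/
theorem existsUnique_of_iso_guarded (E : C ⥤ C) {H : Sh C α ⥤ Sh C α} (i : H ≅ guarded E α)
    {Z Y : Sh C α} (c : Z ⟶ H.obj Z) (m : H.obj Y ⟶ Y) : ∃! h : Z ⟶ Y, h = c ≫ H.map h ≫ m := by
  have := existsUnique_guarded E (c ≫ i.hom.app Z) (i.inv.app Y ≫ m)
  simpa using this

/-- The guarded pointwise extension of a composite. -/
noncomputable def guardedComp (F T : C ⥤ C) : guarded F α ⋙ extP T α ≅ guarded (F ⋙ T) α :=
  Functor.isoWhiskerLeft (later C α) (extPComp T F α)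

end Guarded

/-! ### The final sequence as a fixed point of the guarded extension -/

namespace FinalSequence

variable {F : C ⥤ C} (Φ : FinalSequence.{w} F) {α : Ordinal.{w}}

/-- The value of a final sequence at a successor stage is `F` of its value at the predecessor. -/
noncomputable def predecessorIso {t : Stage α} (ht : IsSuccStage α t) :
    Φ.seq.obj (op t.1) ≅ F.obj (Φ.seq.obj (op (predecessor α t).1)) :=
  Iso.trans
    -- The equality of ordinals is used as two inequalities, which are mutually inverse arrows of
    -- the preorder.
    { hom := Φ.seq.map (homOfLE (predecessor_add_one ht).le).op
      inv := Φ.seq.map (homOfLE (predecessor_add_one ht).ge).op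
      hom_inv_id := (Φ.seq.map_comp _ _).symm.trans (Φ.seq.map_id _)
      inv_hom_id := (Φ.seq.map_comp _ _).symm.trans (Φ.seq.map_id _) }
    (Φ.succIso (predecessor α t).1)

theorem predecessorIso_hom {t : Stage α} (ht : IsSuccStage α t) :
    (Φ.predecessorIso ht).hom = Φ.seq.map (homOfLE (predecessor_add_one ht).le).op ≫
      (Φ.succIso (predecessor α t).1).hom :=
  rfl

/-- Naturality of `succIso` along the predecessor of `t` and `γ`. The ordinal `γ` need not be a
predecessor of a stage: the case `γ = α`, where `γ + 1` lies beyond all stages, is the one used with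
stability. -/
theorem seq_map_predecessorIso_hom {γ : Ordinal.{w}} {t : Stage α} (ht : IsSuccStage α t)
    (h : t.1 ≤ γ + 1) (h' : (predecessor α t).1 ≤ γ) :
    Φ.seq.map (homOfLE h).op ≫ (Φ.predecessorIso ht).hom =
      (Φ.succIso γ).hom ≫ F.map (Φ.seq.map (homOfLE h').op) := by
  rw [predecessorIso_hom, ← Φ.succIso_naturality h' (by simpa using h'), ← Category.assoc,
    ← Φ.seq.map_comp]
  rfl

theorem predecessorIso_hom_eq_stageStr (β : Ordinal.{w}) (h : β + 1 ≤ α) :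
    (Φ.predecessorIso (t := ⟨β + 1, h⟩) ⟨β, rfl⟩).hom = Φ.stageStr α β h := by
  have := Φ.seq_map_predecessorIso_hom (t := ⟨β + 1, h⟩) ⟨β, rfl⟩ le_rfl (predecessor_succ h).le
  refine Eq.trans ?_ this
  exact ((congrArg (fun k => k ≫ _) (Φ.seq.map_id _)).trans (Category.id_comp _)).symm

theorem predecessorIso_naturality {t t' : Stage α} (h : t ≤ t') (ht : IsSuccStage α t)
    (ht' : IsSuccStage α t') :
    Φ.seq.map (homOfLE (show t.1 ≤ t'.1 from h)).op ≫ (Φ.predecessorIso ht).hom =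
      (Φ.predecessorIso ht').hom ≫ F.map (Φ.seq.map
        (homOfLE (show (predecessor α t).1 ≤ (predecessor α t').1 from
          (predecessor α).monotone h)).op) := by
  rw [predecessorIso_hom Φ ht', Category.assoc, ← Φ.seq_map_predecessorIso_hom ht
    ((show t.1 ≤ t'.1 from h).trans (predecessor_add_one ht').ge), ← Category.assoc,
    ← Φ.seq.map_comp]
  rfl

section Guarded

variable [HasWeakSheafify (alexandrov α) C]

/-- The isomorphism between the sheaf of a final sequence and its guarded pointwise extension. -/
noncomputable def guardedIso (α : Ordinal.{w}) [HasWeakSheafify (alexandrov α) C] :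
    Φ.sheaf α ≅ (guarded F α).obj (Φ.sheaf α) :=
  -- Both sides are sheaves and successor stages are cover-dense, so an isomorphism on successor
  -- stages extends to all stages.
  Functor.IsCoverDense.sheafIso (G := (IsSuccStage α).ι) <|
    NatIso.ofComponents
      (fun t => Φ.predecessorIso t.unop.property ≪≫
        guardedUnitIso F (Φ.sheaf α) t.unop.property)
      (fun {t' t} f => by
        have hf := leOfHom ((IsSuccStage α).ι.map f.unop)
        have e₁ := Φ.predecessorIso_naturality hf t.unop.property t'.unop.property
        have e₂ := guardedUnitIso_map F (Φ.sheaf α) hf t.unop.property t'.unop.property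
        refine (Category.assoc _ _ _).symm.trans ?_
        refine (congrArg (fun k => k ≫ (guardedUnitIso F (Φ.sheaf α) t.unop.property).hom)
          e₁).trans ?_
        refine (Category.assoc _ _ _).trans (Eq.trans ?_ (Category.assoc _ _ _).symm)
        exact congrArg _ e₂.symm)

theorem guardedIso_hom_app {t : Stage α} (ht : IsSuccStage α t) :
    (Φ.guardedIso α).hom.hom.app (op t) =
      (Φ.predecessorIso ht).hom ≫ (guardedUnit F (Φ.sheaf α)).app (op t) :=
  congr_app (Functor.IsCoverDense.sheafHom_restrict_eq (G := (IsSuccStage α).ι)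
    (ℱ := (Φ.sheaf α).obj) (ℱ' := (guarded F α).obj (Φ.sheaf α)) _) (op ⟨t, ht⟩)

end Guarded

/-! ### Coalgebras of `F` and cones over the final sequence -/

/-- The same recursion with a constant presheaf as source. Only the target has to be a sheaf, so no
sheafification of the constant presheaf enters. -/
theorem existsUnique_cone (α : Ordinal.{w}) {X : C} (d : X ⟶ F.obj X) :
    ∃! g : (Functor.const (Stage α)ᵒᵖ).obj X ⟶ (stageInclusion α).op ⋙ Φ.seq,
      ∀ t (ht : IsSuccStage α t), g.app (op t) =
        d ≫ F.map (g.app (op (predecessor α t))) ≫ (Φ.predecessorIso ht).inv := by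
  refine existsUnique_of_step (Z := (Functor.const (Stage α)ᵒᵖ).obj X)
    (Y := (stageInclusion α).op ⋙ Φ.seq) (step := fun t ht k =>
    d ≫ F.map (show X ⟶ Φ.seq.obj (op (predecessor α t).1) from k) ≫
      (Φ.predecessorIso ht).inv) ?_ (Φ.isSheaf_restrict α)
  intro t t' h ht ht' k (k' : X ⟶ Φ.seq.obj (op (predecessor α t').1)) e
  obtain rfl : k' ≫ Φ.seq.map (homOfLE (show (predecessor α t).1 ≤ (predecessor α t').1 from
    (predecessor α).monotone h)).op = k := e.trans (Category.id_comp _)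
  refine Eq.trans ?_ (Category.id_comp _).symm
  change (d ≫ F.map k' ≫ (Φ.predecessorIso ht').inv) ≫
    Φ.seq.map (homOfLE (show t.1 ≤ t'.1 from h)).op =
    d ≫ F.map (k' ≫ Φ.seq.map (homOfLE (show (predecessor α t).1 ≤ (predecessor α t').1 from
      (predecessor α).monotone h)).op) ≫ (Φ.predecessorIso ht).inv
  have := Φ.predecessorIso_naturality h ht ht'
  rw [← Iso.inv_comp_eq, ← Category.assoc, ← Iso.eq_comp_inv] at this
  rw [Category.assoc, Category.assoc, this, F.map_comp_assoc]

/-- The cone over the stages of `α` with a given map to the last stage. -/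
def coneOfHom {X : C} (k : X ⟶ Φ.seq.obj (op α)) :
    (Functor.const (Stage α)ᵒᵖ).obj X ⟶ (stageInclusion α).op ⋙ Φ.seq where
  app s := k ≫ Φ.seq.map (homOfLE (show s.unop.1 ≤ α from s.unop.2)).op
  naturality s s' f := by
    refine (Category.id_comp _).trans (Eq.trans ?_ (Category.assoc _ _ _).symm)
    exact congrArg _ (Φ.seq.map_comp _ _)

theorem coneOfHom_app {X : C} (k : X ⟶ Φ.seq.obj (op α)) (s : Stage α) :
    (Φ.coneOfHom k).app (op s) = k ≫ Φ.seq.map (homOfLE (show s.1 ≤ α from s.2)).op :=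
  rfl

/-- The stage `α` is the largest one, so a cone is recovered from its leg there. -/
theorem coneOfHom_eq {X : C}
    (g : (Functor.const (Stage α)ᵒᵖ).obj X ⟶ (stageInclusion α).op ⋙ Φ.seq) :
    Φ.coneOfHom (g.app (op ⟨α, Set.mem_Iic.2 le_rfl⟩)) = g := by
  ext s
  exact (g.naturality (homOfLE (show s.unop ≤ ⟨α, Set.mem_Iic.2 le_rfl⟩ from
    s.unop.2)).op).symm.trans (Category.id_comp _)

theorem coneOfHom_injective {X : C} :
    Function.Injective (Φ.coneOfHom (α := α) (X := X)) := fun k k' h => by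
  have := congr_app h (op ⟨α, Set.mem_Iic.2 le_rfl⟩)
  rw [coneOfHom_app, coneOfHom_app] at this
  refine (Category.comp_id _).symm.trans (Eq.trans ?_ (Category.comp_id _))
  rwa [← Φ.seq.map_id]

/-- Stability rewrites the homomorphism condition as an equation for `k` whose right side passes
through the value at `α + 1`. Two maps into the value at `α` agree once they agree on all successor
stages, and at `t` that right side is `F` of the leg at the predecessor of `t`. -/
theorem isCoalgebraHom_iff (h : Φ.IsStableAt α) {X : C} (d : X ⟶ F.obj X)
    (k : X ⟶ Φ.seq.obj (op α)) :
    d ≫ F.map k = k ≫ (Φ.coalgebra α h).str ↔ ∀ t (ht : IsSuccStage α t),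
      (Φ.coneOfHom k).app (op t) =
        d ≫ F.map ((Φ.coneOfHom k).app (op (predecessor α t))) ≫ (Φ.predecessorIso ht).inv := by
  have : IsIso (Φ.seq.map (homOfLE (le_add_one α)).op) := h
  have e₁ : d ≫ F.map k = k ≫ (Φ.coalgebra α h).str ↔
      k = d ≫ F.map k ≫ (Φ.succIso α).inv ≫ Φ.seq.map (homOfLE (le_add_one α)).op := by
    change d ≫ F.map k = k ≫ inv (Φ.seq.map (homOfLE (le_add_one α)).op) ≫
      (Φ.succIso α).hom ↔ _
    rw [← Category.assoc k, ← Iso.comp_inv_eq, IsIso.eq_comp_inv, Category.assoc, Category.assoc,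
      eq_comm]
  have e₂ (t : Stage α) (ht : IsSuccStage α t) :
      (d ≫ F.map k ≫ (Φ.succIso α).inv ≫ Φ.seq.map (homOfLE (le_add_one α)).op) ≫
        Φ.seq.map (homOfLE (show t.1 ≤ α from t.2)).op =
      d ≫ F.map ((Φ.coneOfHom k).app (op (predecessor α t))) ≫ (Φ.predecessorIso ht).inv := by
    have e₃ := Φ.seq_map_predecessorIso_hom ht ((show t.1 ≤ α from t.2).trans (le_add_one α))
      (show (predecessor α t).1 ≤ α from (predecessor α t).2)
    rw [← Iso.inv_comp_eq, ← Category.assoc, ← Iso.eq_comp_inv] at e₃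
    simp only [Category.assoc]
    refine Eq.trans ?_ (congrArg (fun l => d ≫ l) (F.map_comp_assoc k _ _)).symm
    rw [← Φ.seq.map_comp]
    exact congrArg (fun l => d ≫ F.map k ≫ l) e₃
  rw [e₁]
  constructor
  · intro hk t ht
    rw [← e₂ t ht, ← hk, coneOfHom_app]
  · intro hk
    refine hom_ext_of_succ (Φ.isSheaf_restrict α) (s := ⟨α, Set.mem_Iic.2 le_rfl⟩) ?_
    exact fun t _ ht => (hk t ht).trans (e₂ t ht).symm

theorem existsUnique_coalgebraHom (h : Φ.IsStableAt α) {X : C} (d : X ⟶ F.obj X) :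
    ∃! k : X ⟶ Φ.seq.obj (op α), d ≫ F.map k = k ≫ (Φ.coalgebra α h).str := by
  obtain ⟨g, hg, hu⟩ := Φ.existsUnique_cone α d
  rw [← Φ.coneOfHom_eq g] at hg hu
  exact ⟨_, (Φ.isCoalgebraHom_iff h d _).2 hg, fun k hk =>
    Φ.coneOfHom_injective (hu _ ((Φ.isCoalgebraHom_iff h d k).1 hk))⟩

end FinalSequence

/-- A coalgebra is terminal when every coalgebra has exactly one morphism to it. -/
theorem nonempty_isTerminal_coalgebra {D : Type*} [Category D] {G : D ⥤ D}
    (W : Endofunctor.Coalgebra G) (h : ∀ Z : Endofunctor.Coalgebra G,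
      ∃! f : Z.V ⟶ W.V, Z.str ≫ G.map f = f ≫ W.str) : Nonempty (Limits.IsTerminal W) := by
  choose f hf hu using h
  exact ⟨Limits.IsTerminal.ofUniqueHom (fun Z => ⟨f Z, hf Z⟩)
    fun Z g => Endofunctor.Coalgebra.Hom.ext (hu Z g.f g.h)⟩

/-! ### Coalgebras of a Kleisli lifting -/

namespace KleisliLifting

variable {D : Type*} [Category D] {T : Monad D} {G : D ⥤ D} (L : KleisliLifting T G)

/-- The counit of the Kleisli adjunction. -/
def counit (T : Monad D) (W : D) : (Kleisli.Adjunction.toKleisli T).obj (T.obj W) ⟶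
    (Kleisli.Adjunction.toKleisli T).obj W :=
  ⟨𝟙 _⟩

/-- Splits an arbitrary Kleisli morphism into a part in the image of `K`, where a lifting is known,
and a part that depends only on the target. -/
theorem toKleisli_map_counit (T : Monad D) {Z : D} {W : Kleisli T} (f : Kleisli.mk T Z ⟶ W) :
    (Kleisli.Adjunction.toKleisli T).map f.of ≫ counit T W.of = f := by
  apply Kleisli.hom_ext
  change (f.of ≫ T.η.app _) ≫ T.map (𝟙 _) ≫ T.μ.app _ = _
  simp

theorem comp_toKleisli_map_comp_of {A : Kleisli T} {B B' E : D}
    (a : A ⟶ (Kleisli.Adjunction.toKleisli T).obj B) (u : B ⟶ B')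
    (b : (Kleisli.Adjunction.toKleisli T).obj B' ⟶ (Kleisli.Adjunction.toKleisli T).obj E) :
    (a ≫ (Kleisli.Adjunction.toKleisli T).map u ≫ b).of =
      a.of ≫ T.map u ≫ T.map b.of ≫ T.μ.app E := by
  have h (b : B' ⟶ T.obj E) : (u ≫ T.η.app B') ≫ T.map b ≫ T.μ.app E = u ≫ b := by
    have := T.η.naturality b
    dsimp at this
    rw [Category.assoc, ← reassoc_of% this, T.left_unit]
    exact congrArg _ (Category.comp_id b)
  refine congrArg (fun k => a.of ≫ k) ?_
  refine (congrArg (fun k => T.map k ≫ T.μ.app E) (h b.of)).trans ?_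
  exact T.map_comp_assoc _ _ _

theorem comp_eq_comp_iff {K : Type*} [Category K] {A B P Q R S W U : K} {a : A ⟶ B} {l : B ⟶ S}
    {f : A ⟶ W} {s : W ⟶ S} {i : B ⟶ P} {g : P ⟶ Q} {j : Q ⟶ R} {m : R ⟶ S} {e : S ≅ U}
    {c : W ≅ U} (hl : l = i ≫ g ≫ j ≫ m) (hs : s = c.hom ≫ e.inv) :
    a ≫ l = f ≫ s ↔ f = (a ≫ i) ≫ g ≫ j ≫ m ≫ e.hom ≫ c.inv := by
  subst hl hs
  constructor
  · intro h
    simpa using (congrArg (fun k => k ≫ e.hom ≫ c.inv) h).symm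
  · intro h
    simp [h]

/-- By `toKleisli_map_counit`, the dependence on `f` goes entirely through `G.map f.of`; what
remains is the value of the lifting at one counit. No distributive law has to be extracted. -/
theorem functor_map_eq {A W : D}
    (f : (Kleisli.Adjunction.toKleisli T).obj A ⟶ (Kleisli.Adjunction.toKleisli T).obj W) :
    L.functor.map f = L.iso.hom.app A ≫ (Kleisli.Adjunction.toKleisli T).map (G.map f.of) ≫
      L.iso.inv.app (T.obj W) ≫ L.functor.map (counit T W) := by
  have h := NatIso.naturality_2 L.iso f.of
  have h' := congrArg L.functor.map (toKleisli_map_counit T f)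
  refine h'.symm.trans ((L.functor.map_comp _ _).trans ?_)
  refine (congrArg (fun k => k ≫ L.functor.map (counit T W)) h.symm).trans ?_
  exact (Category.assoc _ _ _).trans (congrArg _ (Category.assoc _ _ _))

/-- Coalgebra morphisms into the image of a coalgebra with invertible structure are the solutions of
a recursive equation in the base category. -/
theorem isCoalgebraHom_iff {W : D} (c : W ≅ G.obj W) (A : Endofunctor.Coalgebra L.functor)
    (f : A.V ⟶ (L.lift ⟨W, c.hom⟩).V) :
    A.str ≫ L.functor.map f = f ≫ (L.lift ⟨W, c.hom⟩).str ↔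
      f.of = (A.str ≫ L.iso.hom.app A.V.of).of ≫ (G ⋙ T.toFunctor).map f.of ≫
        T.map (L.iso.inv.app _ ≫ L.functor.map (counit T W) ≫ L.iso.hom.app W ≫
          (Kleisli.Adjunction.toKleisli T).map c.inv).of ≫ T.μ.app W := by
  have e₁ := comp_eq_comp_iff (a := A.str) (f := f) (e := L.iso.app W)
    (c := (Kleisli.Adjunction.toKleisli T).mapIso c) (L.functor_map_eq (A := A.V.of) f) rfl
  have e₂ := comp_toKleisli_map_comp_of (A.str ≫ L.iso.hom.app A.V.of) (G.map f.of)
    (L.iso.inv.app _ ≫ L.functor.map (counit T W) ≫ L.iso.hom.app W ≫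
      (Kleisli.Adjunction.toKleisli T).map c.inv)
  exact e₁.trans ⟨fun h => (congrArg Kleisli.Hom.of h).trans e₂,
    fun h => Kleisli.hom_ext (h.trans e₂.symm)⟩

end KleisliLifting

end GuardedTrace

/-! ### Finality in sheaves, in the Kleisli category and in `C` -/

theorem mainTheorem1 {C : Type u} [Category.{v} C] (T : Monad C) (F : C ⥤ C) (α : Ordinal.{w})
    [HasWeakSheafify (alexandrov α) C] [HasGlobalSectionsFunctor (alexandrov α) C]
    (Φ : FinalSequence.{w} F) (hΦ : Φ.IsStableAt α)
    (L : KleisliLifting (extPMonad T α) (guarded F α)) :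
    ∃ c : Φ.sheaf α ≅ (guarded F α).obj (Φ.sheaf α),
      (∀ (β : Ordinal.{w}) (h : β + 1 ≤ α), c.hom.hom.app (op ⟨β + 1, h⟩) =
        Φ.stageStr α β h ≫ (guardedUnit F (Φ.sheaf α)).app (op ⟨β + 1, h⟩)) ∧
      Nonempty (Limits.IsTerminal (⟨Φ.sheaf α, c.hom⟩ : Endofunctor.Coalgebra (guarded F α))) ∧
      Nonempty (Limits.IsTerminal (L.lift ⟨Φ.sheaf α, c.hom⟩)) ∧
      L.CapturesInfiniteTraceSemantics ∧
      Nonempty (Limits.IsTerminal (Φ.coalgebra α hΦ)) ∧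
      Nonempty ((Sheaf.Γ (alexandrov α) C).obj (Φ.sheaf α) ≅ (Φ.coalgebra α hΦ).V) ∧
      ∀ X : Endofunctor.Coalgebra (F ⋙ T.toFunctor),
        Nonempty (Unique (L.ofTG (guardedCoalgebra T F α X) ⟶ L.lift ⟨Φ.sheaf α, c.hom⟩)) := by
  let c := Φ.guardedIso α
  have hG : Nonempty (Limits.IsTerminal
      (⟨Φ.sheaf α, c.hom⟩ : Endofunctor.Coalgebra (guarded F α))) := by
    refine nonempty_isTerminal_coalgebra _ fun Z => ?_
    refine (existsUnique_congr fun f => ?_).2 (existsUnique_guarded F Z.str c.inv)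
    -- Invertibility of `c` turns a coalgebra homomorphism into a coalgebra-to-algebra morphism with
    -- algebra `c.inv`.
    rw [eq_comm, ← Iso.eq_comp_inv, Category.assoc]
  have hL : Nonempty (Limits.IsTerminal (L.lift ⟨Φ.sheaf α, c.hom⟩)) := by
    refine nonempty_isTerminal_coalgebra _ fun A => ?_
    -- The algebra supplied here is the part of the equation in `isCoalgebraHom_iff` that does not
    -- involve the unknown morphism.
    obtain ⟨h, hh, hu⟩ := existsUnique_of_iso_guarded (F ⋙ T.toFunctor)
      (guardedComp F T.toFunctor) (A.str ≫ L.iso.hom.app A.V.of).of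
      ((extPMonad T α).map (L.iso.inv.app _ ≫ L.functor.map (KleisliLifting.counit _ _) ≫
        L.iso.hom.app _ ≫ (Kleisli.Adjunction.toKleisli _).map c.inv).of ≫
          (extPMonad T α).μ.app (Φ.sheaf α))
    exact ⟨⟨h⟩, (L.isCoalgebraHom_iff c A ⟨h⟩).2 hh, fun f hf =>
      Kleisli.hom_ext (hu f.of ((L.isCoalgebraHom_iff c A f).1 hf))⟩
  refine ⟨c, fun β h => ?_, hG, hL, ⟨_, _, hG, hL, ⟨Iso.refl _⟩⟩, ?_, ?_, fun X => ?_⟩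
  · exact (Φ.guardedIso_hom_app ⟨β, rfl⟩).trans
      (congrArg (fun k => k ≫ _) (Φ.predecessorIso_hom_eq_stageStr β h))
  · exact nonempty_isTerminal_coalgebra _ fun Z => Φ.existsUnique_coalgebraHom hΦ Z.str
  · have ht : Limits.IsTerminal (⟨α, Set.mem_Iic.2 le_rfl⟩ : Stage α) :=
      Limits.IsTerminal.ofUniqueHom (fun s => homOfLE s.2) fun _ _ => Subsingleton.elim _ _
    have : Limits.HasTerminal (Stage α) := ht.hasTerminal
    exact ⟨(Sheaf.ΓNatIsoSheafSections (alexandrov α) C ht).app (Φ.sheaf α)⟩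
  · obtain ⟨hL⟩ := hL
    exact ⟨⟨⟨hL.from _⟩, fun _ => hL.hom_ext _ _⟩⟩
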